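/- Fix $0<\alpha<1$. For $p\ge 2$ and $c\in\mathbb R$ with $c^2<1/(p-1)$ let $$X^{(p)}(c)=\bigl(e_1,\dots,e_{p-1},X_p(c)\bigr)\in\mathbb R^{p\times p},\qquad X_p(c)=\bigl(c,\dots,c,\sqrt{1-(p-1)c^2}\bigr)^T,$$ where $e_1,\dots,e_{p-1}$ are the first $p-1$ canonical basis vectors of $\mathbb R^p$ (the controls), so that the primary predictor $X_p(c)$ is a unit vector having inner product $c$ with each control. Let $Y\sim N(\mu,\sigma^2 I_p)$ with arbitrary mean $\mu\in\mathbb R^p$ and known $\sigma>0$ (both may depend on $p$). For $M\subseteq\{1,\dots,p\}$ with $p\in M$ let $X_M$ be the submatrix of $X=X^{(p)}(c)$ with the columns in $M$ (always of full rank here), and let $$t_{p\cdot M}=\frac{\hat\beta_{p\cdot M}-\beta_{p\cdot M}}{\sigma\,\bigl[\bigl((X_M^TX_M)^{-1}\bigr)_{pp}\bigr]^{1/2}},$$ where $\hat\beta_{p\cdot M}$ and $\beta_{p\cdot M}$ are the coordinates belonging to predictor $p$ of $\hat\beta_M=(X_M^TX_M)^{-1}X_M^TY$ and $\beta_M=(X_M^TX_M)^{-1}X_M^T\mu$.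 The PoSI1 constant $K_{p\cdot}(X^{(p)}(c),\alpha)$ of the primary predictor is the minimal $K$ such that $$\mathbb P\Bigl[\max_{M\ni p}|t_{p\cdot M}|\le K\Bigr]\ge 1-\alpha .$$ Then this minimum exists for all such $p$ and $c$, for each $p$ its supremum over $c$ is finite, and $$\lim_{p\to\infty}\ \sup_{c^2<1/(p-1)}\frac{K_{p\cdot}(X^{(p)}(c),\alpha)}{\sqrt p}=\max_{0<r<1}\frac{\varphi(\Phi^{-1}(r))}{\sqrt{1-r}}=0.6363\ldots,$$ where $\varphi$ and $\Phi$ are the density and the distribution function of the standard normal distribution; the maximum is attained and lies in $[0.6363,0.6364)$. -/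

import Mathlib

open MeasureTheory ProbabilityTheory

namespace PoSI

noncomputable section

/-- The submatrix `X_M` of the design `X` whose columns are the predictors of the submodel `M`. -/
def subdesign {n p : ℕ} (X : Matrix (Fin n) (Fin p) ℝ) (M : Finset (Fin p)) :
    Matrix (Fin n) M ℝ :=
  X.submatrix id (fun j : M => (j : Fin p))

/-- The universe of all full-rank submodels of `X`. -/
def allModels {n p : ℕ} (X : Matrix (Fin n) (Fin p) ℝ) : Set (Finset (Fin p)) :=
  {M | (subdesign X M).rank = M.card}

/-- The models of the universe `U` that contain the predictor `j`. -/
def modelsContaining {p : ℕ} (U : Set (Finset (Fin p))) (j : Fin p) : Set (Finset (Fin p)) :=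
  {M | j ∈ M ∧ M ∈ U}

/-- The least squares coefficients `(X_Mᵀ X_M)⁻¹ X_Mᵀ y` in the submodel `M`.  At the response `y`
this is the estimate; at the mean vector it is the target of that estimate. -/
def lsCoeff {n p : ℕ} (X : Matrix (Fin n) (Fin p) ℝ) (M : Finset (Fin p)) (y : Fin n → ℝ) :
    M → ℝ :=
  Matrix.mulVec (((subdesign X M).transpose * subdesign X M)⁻¹ * (subdesign X M).transpose) y

/-- The test statistic of predictor `j` in the submodel `M` for the response `y`, mean vector `m`
and known error standard deviation `s`: the estimate minus its target, divided by its standard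
deviation. -/
def tStat {n p : ℕ} (X : Matrix (Fin n) (Fin p) ℝ) (M : Finset (Fin p)) (j : M)
    (m : Fin n → ℝ) (s : ℝ) (y : Fin n → ℝ) : ℝ :=
  (lsCoeff X M y j - lsCoeff X M m j) /
    (Real.sqrt ((((subdesign X M).transpose * subdesign X M)⁻¹) j j) * s)

/-- The law `N(m, s² I)` of the response. -/
def responseLaw {n : ℕ} (m : Fin n → ℝ) (s : ℝ) : Measure (Fin n → ℝ) :=
  Measure.pi (fun i => gaussianReal (m i) (Real.toNNReal (s ^ 2)))

/-- The set of all `K` such that, with probability at least `1 - α`, the maximum of the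
`|t|`-statistics of predictor `j` over all models of the universe `U` that contain `j` is at
most `K`. -/
def posi1Levels {n p : ℕ} (X : Matrix (Fin n) (Fin p) ℝ) (U : Set (Finset (Fin p))) (j : Fin p)
    (α : ℝ) (m : Fin n → ℝ) (s : ℝ) : Set ℝ :=
  {K | 1 - α ≤ (responseLaw m s).real
    {y | ∀ (M : Finset (Fin p)) (h : M ∈ modelsContaining U j),
      |tStat X M ⟨j, h.1⟩ m s y| ≤ K}}

/-- The PoSI1 constant of predictor `j` for known error standard deviation: the minimal level
`K` in `posi1Levels`. -/
def posi1Constant {n p : ℕ} (X : Matrix (Fin n) (Fin p) ℝ) (U : Set (Finset (Fin p)))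
    (j : Fin p) (α : ℝ) (m : Fin n → ℝ) (s : ℝ) : ℝ :=
  sInf (posi1Levels X U j α m s)

/-- The design with `n` controls (hence `p = n + 1` predictors): columns `e_1, …, e_n` and, as the
last column, the primary predictor `(c, …, c, √(1 - n c²))`. -/
def controlDesign (n : ℕ) (c : ℝ) : Matrix (Fin (n + 1)) (Fin (n + 1)) ℝ :=
  fun i j =>
    if j = Fin.last n then
      (if i = Fin.last n then Real.sqrt (1 - (n : ℝ) * c ^ 2) else c)
    else (if i = j then 1 else 0)

/-- The quantile function of the standard normal distribution, the inverse of its distribution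
function on `(0, 1)`. -/
def stdNormalQuantile (r : ℝ) : ℝ :=
  sInf {x : ℝ | r ≤ cdf (gaussianReal 0 1) x}

/-- The function `r ↦ φ(Φ⁻¹(r)) / √(1 - r)`. -/
def rateFun (r : ℝ) : ℝ :=
  gaussianPDFReal 0 1 (stdNormalQuantile r) / Real.sqrt (1 - r)

end

end PoSI

namespace PoSI

noncomputable section

open Filter Topology Set

/-! Standardize the response to `z` with independent standard normal coordinates. If `A` is the set
of controls left out of a submodel, the residual of the primary predictor on the remaining controls
is explicit, and its statistic is `(d z_p + c ∑_{i ∈ A} z_i) / √(d² + c²|A|)` with `d = √(1 - nc²)`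
and `p = n + 1` (`tStat_last`). The constant is thus a quantile of the maximum over `A`. Divided by
`√p`, its supremum over `c` has a limit independent of `α`, because both bounds below hold with
probability tending to one.

Lower bound (`whp_notMem_levelSet`): take `c = d = 1/√p` and let `A` be the controls with `z_i > t`.
By the law of large numbers `|A| ≈ p (1 - Φ(t))` and `∑_A z_i ≈ p φ(t)`, so the statistic is about
`√p φ(t)/√(1 - Φ(t))`; choose `t` optimal.

Upper bound (`whp_sum_le`, `whp_mem_levelSet`): for every `t`, `∑_A z_i ≤ ∑ max(z_i - t, 0) + t|A|`,
where the first sum is about `p (φ(t) - t(1 - Φ(t)))`. If `1 - Φ(t) = |A|/p`, the right side is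
about `p φ(t) ≤ L √p √|A|`. Compactness reduces this to finitely many `t` when `|A|/p` stays away
from 0 (`exists_finite_grid`), and fourth moments control smaller `A` (`sum_le_of_sum_pow_four_le`).
The `z_p` term is negligible, and nothing in the estimate depends on `c`. -/

/-! ### Standard normal density, tail and quantile. -/

/-- The standard normal density. -/
def normalPDF (t : ℝ) : ℝ := gaussianPDFReal 0 1 t

/-- The upper tail probability of the standard normal distribution. -/
def normalTail (t : ℝ) : ℝ := 1 - cdf (gaussianReal 0 1) t

lemma normalPDF_eq (t : ℝ) : normalPDF t = (√(2 * Real.pi))⁻¹ * Real.exp (-t ^ 2 / 2) := by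
  simp [normalPDF, gaussianPDFReal]

lemma normalPDF_pos (t : ℝ) : 0 < normalPDF t := gaussianPDFReal_pos _ _ _ one_ne_zero

lemma hasDerivAt_normalPDF (t : ℝ) : HasDerivAt normalPDF (-t * normalPDF t) t := by
  have h : HasDerivAt (fun t : ℝ => (√(2 * Real.pi))⁻¹ * Real.exp (-t ^ 2 / 2))
      ((√(2 * Real.pi))⁻¹ * (Real.exp (-t ^ 2 / 2) * (-(2 * t) / 2))) t := by
    have := (((hasDerivAt_pow 2 t).neg.div_const 2).exp.const_mul (√(2 * Real.pi))⁻¹)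
    simpa using this
  rw [funext normalPDF_eq]
  convert h using 1
  ring

lemma continuous_normalPDF : Continuous normalPDF :=
  continuous_iff_continuousAt.2 fun t => (hasDerivAt_normalPDF t).continuousAt

lemma integrable_normalPDF : Integrable normalPDF := integrable_gaussianPDFReal 0 1

lemma cdf_eq_setIntegral (t : ℝ) :
    cdf (gaussianReal 0 1) t = ∫ x in Iic t, normalPDF x := by
  rw [cdf_eq_real, Measure.real, gaussianReal_apply_eq_integral _ one_ne_zero]
  exact ENNReal.toReal_ofReal (setIntegral_nonneg measurableSet_Iic fun x _ => (normalPDF_pos x).le)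

lemma cdf_eq_add_intervalIntegral (t : ℝ) :
    cdf (gaussianReal 0 1) t = cdf (gaussianReal 0 1) 0 + ∫ x in (0 : ℝ)..t, normalPDF x := by
  rw [cdf_eq_setIntegral, cdf_eq_setIntegral,
    ← intervalIntegral.integral_Iic_sub_Iic integrable_normalPDF.integrableOn
      integrable_normalPDF.integrableOn]
  ring

lemma hasDerivAt_cdf (t : ℝ) : HasDerivAt (cdf (gaussianReal 0 1)) (normalPDF t) t := by
  rw [show (cdf (gaussianReal 0 1) : ℝ → ℝ) = _ from funext cdf_eq_add_intervalIntegral]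
  exact (intervalIntegral.integral_hasDerivAt_right
    (continuous_normalPDF.intervalIntegrable _ _)
    (continuous_normalPDF.stronglyMeasurableAtFilter _ _)
    continuous_normalPDF.continuousAt).const_add _

lemma hasDerivAt_normalTail (t : ℝ) : HasDerivAt normalTail (-normalPDF t) t :=
  (hasDerivAt_cdf t).const_sub 1

lemma strictMono_cdf : StrictMono (cdf (gaussianReal 0 1)) :=
  strictMono_of_deriv_pos fun t => by
    rw [(hasDerivAt_cdf t).deriv]; exact normalPDF_pos t

lemma continuous_cdf : Continuous (cdf (gaussianReal 0 1)) :=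
  continuous_iff_continuousAt.2 fun t => (hasDerivAt_cdf t).continuousAt

lemma continuous_normalTail : Continuous normalTail := continuous_const.sub continuous_cdf

lemma cdf_lt_one (t : ℝ) : cdf (gaussianReal 0 1) t < 1 :=
  (strictMono_cdf (lt_add_one t)).trans_le (cdf_le_one _ _)

lemma cdf_pos (t : ℝ) : 0 < cdf (gaussianReal 0 1) t :=
  (cdf_nonneg _ _).trans_lt (strictMono_cdf (sub_one_lt t))

lemma normalTail_pos (t : ℝ) : 0 < normalTail t := sub_pos.2 (cdf_lt_one t)

lemma normalTail_zero : normalTail 0 = 1 / 2 := by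
  have h : (gaussianReal 0 1).real (Ioi 0) = 1 / 2 := by
    rw [Measure.real, gaussianReal_apply_eq_integral _ one_ne_zero,
      ENNReal.toReal_ofReal (setIntegral_nonneg measurableSet_Ioi fun x _ =>
        gaussianPDFReal_nonneg 0 1 x)]
    have h1 := integral_gaussian_Ioi (1 / 2)
    have h2 : ∀ x, gaussianPDFReal 0 1 x = (√(2 * Real.pi))⁻¹ * Real.exp (-(1 / 2) * x ^ 2) := by
      intro x
      have := normalPDF_eq x
      rw [normalPDF] at this
      rw [this]; ring_nf
    simp_rw [h2]
    rw [integral_const_mul, h1]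
    have : Real.pi / (1 / 2) = 2 * Real.pi := by ring
    rw [this]
    have : √(2 * Real.pi) ≠ 0 := by positivity
    field_simp
  rw [normalTail, cdf_eq_real, ← h, ← compl_Iic]
  exact (probReal_compl_eq_one_sub measurableSet_Iic).symm

lemma normalTail_eq_real (t : ℝ) : normalTail t = (gaussianReal 0 1).real (Ioi t) := by
  rw [normalTail, cdf_eq_real, ← compl_Iic]
  exact (probReal_compl_eq_one_sub measurableSet_Iic).symm

lemma tendsto_normalTail_atTop : Tendsto normalTail atTop (𝓝 0) := by
  have := (tendsto_cdf_atTop (gaussianReal 0 1)).const_sub 1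
  rwa [sub_self] at this

lemma tendsto_normalPDF_atTop : Tendsto normalPDF atTop (𝓝 0) := by
  rw [funext normalPDF_eq, ← mul_zero (√(2 * Real.pi))⁻¹]
  refine (Real.tendsto_exp_atBot.comp ?_).const_mul _
  have : Tendsto (fun t : ℝ => t ^ 2 / 2) atTop atTop :=
    (tendsto_pow_atTop two_ne_zero).atTop_div_const two_pos
  refine (tendsto_neg_atTop_atBot.comp this).congr fun t => ?_
  simp [neg_div]

lemma stdNormalQuantile_cdf (t : ℝ) : stdNormalQuantile (cdf (gaussianReal 0 1) t) = t := by
  have : {x : ℝ | cdf (gaussianReal 0 1) t ≤ cdf (gaussianReal 0 1) x} = Ici t := by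
    ext x; simp [strictMono_cdf.le_iff_le]
  rw [stdNormalQuantile, this, csInf_Ici]

lemma exists_cdf_eq {r : ℝ} (hr : r ∈ Ioo (0 : ℝ) 1) : ∃ t, cdf (gaussianReal 0 1) t = r := by
  have h0 := (tendsto_cdf_atBot (gaussianReal 0 1)).eventually (gt_mem_nhds hr.1)
  have h1 := (tendsto_cdf_atTop (gaussianReal 0 1)).eventually (lt_mem_nhds hr.2)
  obtain ⟨a, ha⟩ := h0.exists
  obtain ⟨b, hb⟩ := h1.exists
  exact mem_range_of_exists_le_of_exists_ge continuous_cdf ⟨a, ha.le⟩ ⟨b, hb.le⟩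

/-- The substitution `r = Φ(t)` removes the quantile, so the maximization runs over the threshold
`t`. -/
lemma rateFun_image : rateFun '' Ioo 0 1 = range fun t => normalPDF t / √(normalTail t) := by
  ext y
  constructor
  · rintro ⟨r, hr, rfl⟩
    obtain ⟨t, rfl⟩ := exists_cdf_eq hr
    exact ⟨t, by rw [rateFun, stdNormalQuantile_cdf]; rfl⟩
  · rintro ⟨t, rfl⟩
    exact ⟨_, ⟨cdf_pos t, cdf_lt_one t⟩, by rw [rateFun, stdNormalQuantile_cdf]; rfl⟩

/-! ### The maximum of the rate function and its numerical value. -/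

/-- The difference `q (1 - Φ) - φ²` has derivative `φ (2tφ - q)`, so it decreases on `[T, ∞)`; its
limit at infinity is 0. -/
lemma sq_normalPDF_le_of_forall_le {T q : ℝ} (h : ∀ t ≥ T, 2 * t * normalPDF t ≤ q) :
    normalPDF T ^ 2 ≤ q * normalTail T := by
  have hd : ∀ t, HasDerivAt (fun t => q * normalTail t - normalPDF t ^ 2)
      (q * (-normalPDF t) - 2 * normalPDF t * (-t * normalPDF t)) t := by
    intro t
    convert! ((hasDerivAt_normalTail t).const_mul q).sub ((hasDerivAt_normalPDF t).pow 2) using 1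
    simp
  have hanti : AntitoneOn (fun t => q * normalTail t - normalPDF t ^ 2) (Ici T) := by
    refine antitoneOn_of_deriv_nonpos (convex_Ici T)
      (fun t _ => (hd t).continuousAt.continuousWithinAt)
      (fun t _ => (hd t).differentiableAt.differentiableWithinAt) fun t ht => ?_
    rw [interior_Ici] at ht
    rw [(hd t).deriv]
    nlinarith [mul_le_mul_of_nonneg_right (h t (le_of_lt ht)) (normalPDF_pos t).le]
  have hlim : Tendsto (fun t => q * normalTail t - normalPDF t ^ 2) atTop (𝓝 0) := by
    simpa using (tendsto_normalTail_atTop.const_mul q).sub (tendsto_normalPDF_atTop.pow 2)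
  -- With `H` the difference, `-H(t) + 2H(T) ≥ H(T)` for `t ≥ T`; the limit gives `2H(T) ≥ H(T)`,
  -- that is `H(T) ≥ 0`.
  have := ge_of_tendsto (b := q * normalTail T - normalPDF T ^ 2) (f := fun t =>
    -(q * normalTail t - normalPDF t ^ 2) + 2 * (q * normalTail T - normalPDF T ^ 2))
    (a := 0 + 2 * (q * normalTail T - normalPDF T ^ 2)) (x := atTop) (by
      simpa using hlim.neg.add_const (2 * (q * normalTail T - normalPDF T ^ 2))) (by
      filter_upwards [eventually_ge_atTop T] with t ht
      have := hanti (mem_Ici.2 le_rfl) (mem_Ici.2 ht) ht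
      simp only at this
      linarith)
  linarith

lemma hasDerivAt_mul_normalPDF (t : ℝ) :
    HasDerivAt (fun t => t * normalPDF t) ((1 - t ^ 2) * normalPDF t) t := by
  convert! (hasDerivAt_id t).mul (hasDerivAt_normalPDF t) using 1
  simp; ring

lemma monotoneOn_mul_normalPDF : MonotoneOn (fun t => t * normalPDF t) (Icc 0 1) := by
  refine monotoneOn_of_deriv_nonneg (convex_Icc 0 1)
      (fun t _ => (hasDerivAt_mul_normalPDF t).continuousAt.continuousWithinAt)
      (fun t _ => (hasDerivAt_mul_normalPDF t).differentiableAt.differentiableWithinAt)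
      fun t ht => ?_
  rw [interior_Icc] at ht
  rw [(hasDerivAt_mul_normalPDF t).deriv]
  exact mul_nonneg (by nlinarith [ht.1, ht.2]) (normalPDF_pos t).le

lemma antitoneOn_mul_normalPDF : AntitoneOn (fun t => t * normalPDF t) (Ici 1) := by
  refine antitoneOn_of_deriv_nonpos (convex_Ici 1)
      (fun t _ => (hasDerivAt_mul_normalPDF t).continuousAt.continuousWithinAt)
      (fun t _ => (hasDerivAt_mul_normalPDF t).differentiableAt.differentiableWithinAt)
      fun t ht => ?_
  rw [interior_Ici] at ht
  rw [(hasDerivAt_mul_normalPDF t).deriv]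
  exact mul_nonpos_of_nonpos_of_nonneg (by nlinarith [mem_Ioi.1 ht]) (normalPDF_pos t).le

lemma inv_sqrt_two_pi_bounds :
    0.398942 ≤ (√(2 * Real.pi))⁻¹ ∧ (√(2 * Real.pi))⁻¹ ≤ 0.398943 := by
  have h1 := Real.pi_gt_d6
  have h2 := Real.pi_lt_d6
  constructor
  · rw [le_inv_comm₀ (by norm_num) (by positivity), Real.sqrt_le_left (by norm_num)]
    norm_num; linarith
  · rw [inv_le_comm₀ (by positivity) (by norm_num), Real.le_sqrt (by norm_num)]
    · norm_num; linarith
    · positivity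

/-- Taylor expansion to order 4; `1/100 = 6/(5!·5)` is the remainder constant of `Real.exp_bound`
for five terms. -/
lemma exp_neg_bounds {u : ℝ} (h0 : 0 ≤ u) (h1 : u ≤ 1) :
    1 - u + u ^ 2 / 2 - u ^ 3 / 6 + u ^ 4 / 24 - u ^ 5 / 100 ≤ Real.exp (-u) ∧
    Real.exp (-u) ≤ 1 - u + u ^ 2 / 2 - u ^ 3 / 6 + u ^ 4 / 24 + u ^ 5 / 100 := by
  have h := Real.exp_bound (x := -u) (by rw [abs_neg, abs_of_nonneg h0]; exact h1)
    (n := 5) (by norm_num)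
  rw [abs_neg, abs_of_nonneg h0, abs_le] at h
  simp [Finset.sum_range_succ, Nat.factorial] at h
  constructor <;> nlinarith [h.1, h.2]

lemma integral_exp_neg_sq_bounds :
    0.57601 ≤ (∫ x in (0 : ℝ)..0.6122, Real.exp (-x ^ 2 / 2)) ∧
    (∫ x in (0 : ℝ)..0.6122, Real.exp (-x ^ 2 / 2)) ≤ 0.57603 := by
  have hb : ∀ x ∈ Icc (0 : ℝ) 0.6122,
      1 - x ^ 2 / 2 + x ^ 4 / 8 - x ^ 6 / 48 + x ^ 8 / 384 - x ^ 10 / 3200 ≤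
        Real.exp (-x ^ 2 / 2) ∧
      Real.exp (-x ^ 2 / 2) ≤
        1 - x ^ 2 / 2 + x ^ 4 / 8 - x ^ 6 / 48 + x ^ 8 / 384 + x ^ 10 / 3200 := by
    intro x hx
    have := exp_neg_bounds (u := x ^ 2 / 2) (by positivity) (by nlinarith [hx.1, hx.2])
    rw [← neg_div] at this
    constructor
    · convert this.1 using 1; ring
    · convert this.2 using 1; ring
  have hi : ∀ f : ℝ → ℝ, Continuous f → IntervalIntegrable f volume (0 : ℝ) 0.6122 :=
    fun f hf => hf.intervalIntegrable _ _
  constructor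
  · refine le_trans ?_ (intervalIntegral.integral_mono_on (by norm_num)
      (hi _ (by fun_prop)) (hi _ (by fun_prop)) fun x hx => (hb x hx).1)
    rw [intervalIntegral.integral_eq_sub_of_hasDerivAt (f := fun x => x - x ^ 3 / 6 + x ^ 5 / 40
      - x ^ 7 / 336 + x ^ 9 / 3456 - x ^ 11 / 35200) (fun x _ => ?_) (hi _ (by fun_prop))]
    · norm_num
    · convert! ((((((hasDerivAt_id x).sub ((hasDerivAt_pow 3 x).div_const 6)).add
        ((hasDerivAt_pow 5 x).div_const 40)).sub ((hasDerivAt_pow 7 x).div_const 336)).add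
        ((hasDerivAt_pow 9 x).div_const 3456)).sub ((hasDerivAt_pow 11 x).div_const 35200)) using 1
      norm_num; ring
  · refine le_trans (intervalIntegral.integral_mono_on (by norm_num)
      (hi _ (by fun_prop)) (hi _ (by fun_prop)) fun x hx => (hb x hx).2) ?_
    rw [intervalIntegral.integral_eq_sub_of_hasDerivAt (f := fun x => x - x ^ 3 / 6 + x ^ 5 / 40
      - x ^ 7 / 336 + x ^ 9 / 3456 + x ^ 11 / 35200) (fun x _ => ?_) (hi _ (by fun_prop))]
    · norm_num
    · convert! ((((((hasDerivAt_id x).sub ((hasDerivAt_pow 3 x).div_const 6)).add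
        ((hasDerivAt_pow 5 x).div_const 40)).sub ((hasDerivAt_pow 7 x).div_const 336)).add
        ((hasDerivAt_pow 9 x).div_const 3456)).add ((hasDerivAt_pow 11 x).div_const 35200)) using 1
      norm_num; ring

lemma normalPDF_point_bounds :
    0.330767 ≤ normalPDF 0.6122 ∧ normalPDF 0.6122 ≤ 0.330773 := by
  have h := exp_neg_bounds (u := (0.6122 : ℝ) ^ 2 / 2) (by norm_num) (by norm_num)
  rw [← neg_div] at h
  obtain ⟨s0, s1⟩ := inv_sqrt_two_pi_bounds
  rw [normalPDF_eq]
  constructor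
  · calc (0.330767 : ℝ) ≤ 0.398942 * 0.829116 := by norm_num
      _ ≤ _ := by
        gcongr
        exact le_trans (by norm_num) h.1
  · calc _ ≤ (0.398943 : ℝ) * 0.829121 := by
          gcongr
          exact le_trans h.2 (by norm_num)
      _ ≤ _ := by norm_num

lemma normalTail_point_bounds :
    0.270196 ≤ normalTail 0.6122 ∧ normalTail 0.6122 ≤ 0.270206 := by
  have h : normalTail 0.6122 = 1 / 2 -
      (√(2 * Real.pi))⁻¹ * ∫ x in (0 : ℝ)..0.6122, Real.exp (-x ^ 2 / 2) := by
    rw [← intervalIntegral.integral_const_mul]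
    simp_rw [← normalPDF_eq]
    rw [normalTail, cdf_eq_add_intervalIntegral, ← normalTail_zero, normalTail]
    ring
  obtain ⟨s0, s1⟩ := inv_sqrt_two_pi_bounds
  obtain ⟨i0, i1⟩ := integral_exp_neg_sq_bounds
  rw [h]
  constructor
  · have : (√(2 * Real.pi))⁻¹ * ∫ x in (0 : ℝ)..0.6122, Real.exp (-x ^ 2 / 2) ≤
        0.398943 * 0.57603 := by gcongr
    linarith
  · have : 0.398942 * 0.57601 ≤
        (√(2 * Real.pi))⁻¹ * ∫ x in (0 : ℝ)..0.6122, Real.exp (-x ^ 2 / 2) := by gcongr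
    linarith

lemma normalPDF_le (t : ℝ) : normalPDF t ≤ 0.398943 := by
  rw [normalPDF_eq]
  refine (mul_le_of_le_one_right (by positivity) ?_).trans inv_sqrt_two_pi_bounds.2
  exact Real.exp_le_one_iff.2 (by nlinarith [sq_nonneg t])

lemma sq_normalPDF_le_of_nonpos {t : ℝ} (ht : t ≤ 0) : normalPDF t ^ 2 ≤ 0.4 * normalTail t := by
  have h1 := normalPDF_le t
  have h2 := normalPDF_pos t
  have h3 : 1 / 2 ≤ normalTail t := by
    rw [← normalTail_zero]
    exact sub_le_sub_left (strictMono_cdf.monotone ht) 1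
  nlinarith

lemma sq_normalPDF_le_of_two_le {t : ℝ} (ht : 2 ≤ t) :
    normalPDF t ^ 2 ≤ 0.4 * normalTail t := by
  refine sq_normalPDF_le_of_forall_le fun x hx => ?_
  have h1 : x * normalPDF x ≤ 2 * normalPDF 2 :=
    antitoneOn_mul_normalPDF (by simp) (mem_Ici.2 (by linarith)) (ht.trans hx)
  have h2 : normalPDF 2 ≤ 0.398943 * (1 / 4) := by
    rw [normalPDF_eq]
    refine mul_le_mul inv_sqrt_two_pi_bounds.2 ?_ (Real.exp_pos _).le (by norm_num)
    have : (2 : ℝ) ≤ Real.exp 1 := by linarith [Real.add_one_le_exp (1 : ℝ)]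
    rw [show (-2 ^ 2 / 2 : ℝ) = -(1 + 1) by norm_num, Real.exp_neg, Real.exp_add, one_div]
    apply inv_anti₀ (by norm_num)
    nlinarith
  norm_num at h2 ⊢
  linarith

/-- At a critical point of `φ²/(1 - Φ)` the value equals `2tφ(t)`. The point 0.6122 is nearly
critical; adding a multiple `c` of the tail makes it exactly critical for `G`, and monotonicity of
`tφ(t)` on `[0, 1]` makes it the minimum of `G` there. The correction is smaller than the margin at
that point. -/
lemma sq_normalPDF_le_of_mem_Icc {t : ℝ} (ht : t ∈ Icc (0 : ℝ) 1) :
    normalPDF t ^ 2 ≤ 0.63639 ^ 2 * normalTail t := by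
  obtain ⟨p0, p1⟩ := normalPDF_point_bounds
  obtain ⟨q0, q1⟩ := normalTail_point_bounds
  set c := 2 * (0.6122 * normalPDF 0.6122) - 0.63639 ^ 2 with hc
  have hc' : |c| ≤ 0.00001 := by
    rw [abs_le]; constructor <;> norm_num at p0 p1 hc ⊢ <;> linarith
  let G : ℝ → ℝ := fun t => 0.63639 ^ 2 * normalTail t - normalPDF t ^ 2 + c * normalTail t
  have hd : ∀ t, HasDerivAt G (2 * normalPDF t * (t * normalPDF t - 0.6122 * normalPDF 0.6122))
      t := by
    intro t
    convert! (((hasDerivAt_normalTail t).const_mul (0.63639 ^ 2)).sub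
      ((hasDerivAt_normalPDF t).pow 2)).add ((hasDerivAt_normalTail t).const_mul c) using 1
    simp; ring
  have hG : G 0.6122 ≤ G t := by
    rcases le_total t 0.6122 with h | h
    · refine antitoneOn_of_deriv_nonpos (convex_Icc 0 0.6122)
        (fun t _ => (hd t).continuousAt.continuousWithinAt)
        (fun t _ => (hd t).differentiableAt.differentiableWithinAt) (fun x hx => ?_)
        ⟨ht.1, h⟩ ⟨by norm_num, le_rfl⟩ h
      rw [interior_Icc] at hx
      rw [(hd x).deriv]
      have := monotoneOn_mul_normalPDF ⟨hx.1.le, by linarith [hx.2]⟩ ⟨by norm_num, by norm_num⟩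
        hx.2.le
      exact mul_nonpos_of_nonneg_of_nonpos (by linarith [normalPDF_pos x]) (sub_nonpos.2 this)
    · refine monotoneOn_of_deriv_nonneg (convex_Icc 0.6122 1)
        (fun t _ => (hd t).continuousAt.continuousWithinAt)
        (fun t _ => (hd t).differentiableAt.differentiableWithinAt) (fun x hx => ?_)
        ⟨le_rfl, by norm_num⟩ ⟨h, ht.2⟩ h
      rw [interior_Icc] at hx
      rw [(hd x).deriv]
      have := monotoneOn_mul_normalPDF ⟨by norm_num, by norm_num⟩
        ⟨by linarith [hx.1], hx.2.le⟩ hx.1.le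
      exact mul_nonneg (by linarith [normalPDF_pos x]) (sub_nonneg.2 this)
  have ht1 : normalTail t ≤ 1 / 2 := by
    rw [← normalTail_zero]
    exact sub_le_sub_left (strictMono_cdf.monotone ht.1) 1
  have h1 : |c * (normalTail 0.6122 - normalTail t)| ≤ 0.00001 * (1 / 2) := by
    rw [abs_mul]
    refine mul_le_mul hc' ?_ (abs_nonneg _) (by norm_num)
    rw [abs_le]
    constructor <;> linarith [normalTail_pos t]
  have h2 := (abs_le.1 h1).1
  simp only [G] at hG
  nlinarith

/-- On `[1, ∞)` the function `2tφ` decreases, so `q (1 - Φ) - φ²` with `q = 0.63639²` can only rise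
first and then fall. It is nonnegative at 1 and tends to 0, hence is nonnegative throughout. -/
lemma sq_normalPDF_le (t : ℝ) : normalPDF t ^ 2 ≤ 0.63639 ^ 2 * normalTail t := by
  have hpos := normalTail_pos t
  rcases le_total t 0 with h0 | h0
  · nlinarith [sq_normalPDF_le_of_nonpos h0]
  rcases le_total t 1 with h1 | h1
  · exact sq_normalPDF_le_of_mem_Icc ⟨h0, h1⟩
  by_cases h : 2 * t * normalPDF t ≤ 0.63639 ^ 2
  · refine sq_normalPDF_le_of_forall_le fun x hx => ?_
    have := antitoneOn_mul_normalPDF (mem_Ici.2 h1) (mem_Ici.2 (h1.trans hx)) hx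
    simp only at this
    linarith
  · have hd : ∀ t, HasDerivAt (fun t => 0.63639 ^ 2 * normalTail t - normalPDF t ^ 2)
        (normalPDF t * (2 * (t * normalPDF t) - 0.63639 ^ 2)) t := by
      intro t
      convert! ((hasDerivAt_normalTail t).const_mul (0.63639 ^ 2)).sub
        ((hasDerivAt_normalPDF t).pow 2) using 1
      simp; ring
    have hm : MonotoneOn (fun t => 0.63639 ^ 2 * normalTail t - normalPDF t ^ 2) (Icc 1 t) := by
      refine monotoneOn_of_deriv_nonneg (convex_Icc 1 t)
        (fun t _ => (hd t).continuousAt.continuousWithinAt)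
        (fun t _ => (hd t).differentiableAt.differentiableWithinAt) (fun x hx => ?_)
      rw [interior_Icc] at hx
      rw [(hd x).deriv]
      have := antitoneOn_mul_normalPDF (mem_Ici.2 hx.1.le) (mem_Ici.2 h1) hx.2.le
      simp only at this
      exact mul_nonneg (normalPDF_pos x).le (by linarith)
    have h3 := hm ⟨le_rfl, h1⟩ ⟨h1, le_rfl⟩ h1
    have h4 := sq_normalPDF_le_of_mem_Icc (t := 1) ⟨zero_le_one, le_rfl⟩
    simp only at h3
    linarith

lemma div_sqrt_normalTail_le_iff {q t : ℝ} (hq : 0 ≤ q) :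
    normalPDF t / √(normalTail t) ≤ q ↔ normalPDF t ^ 2 ≤ q ^ 2 * normalTail t := by
  rw [div_le_iff₀ (Real.sqrt_pos.2 (normalTail_pos t)),
    ← sq_le_sq₀ (normalPDF_pos t).le (by positivity), mul_pow, Real.sq_sqrt (normalTail_pos t).le]

lemma exists_isGreatest_rateFun :
    ∃ L : ℝ, IsGreatest (rateFun '' Ioo 0 1) L ∧ 0.6363 ≤ L ∧ L < 0.6364 := by
  rw [rateFun_image]
  set F : ℝ → ℝ := fun t => normalPDF t / √(normalTail t)
  have hF : Continuous F := continuous_normalPDF.div (continuous_normalTail.sqrt)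
    fun t => (Real.sqrt_pos.2 (normalTail_pos t)).ne'
  have h0 : 0.6363 ≤ F 0.6122 := by
    rw [le_div_iff₀ (Real.sqrt_pos.2 (normalTail_pos _)),
      ← sq_le_sq₀ (by positivity) (normalPDF_pos _).le, mul_pow,
      Real.sq_sqrt (normalTail_pos _).le]
    obtain ⟨p0, p1⟩ := normalPDF_point_bounds
    obtain ⟨q0, q1⟩ := normalTail_point_bounds
    nlinarith
  -- Outside `[0, 2]` the squared rate is at most `0.4 < 0.6363²`, so a maximizer on this compact
  -- interval is global.
  obtain ⟨t, ht, hmax⟩ := isCompact_Icc.exists_isMaxOn (s := Icc (0 : ℝ) 2) ⟨0, by simp⟩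
    hF.continuousOn
  have h1 : F 0.6122 ≤ F t := hmax ⟨by norm_num, by norm_num⟩
  refine ⟨F t, ⟨⟨t, rfl⟩, ?_⟩, h0.trans h1, ?_⟩
  · rintro _ ⟨x, rfl⟩
    have hx : normalPDF x ^ 2 ≤ 0.4 * normalTail x → F x ≤ F t := fun h => by
      refine le_trans ?_ (h0.trans h1)
      rw [div_sqrt_normalTail_le_iff (by norm_num)]
      nlinarith [normalTail_pos x]
    rcases le_total x 0 with h | h
    · exact hx (sq_normalPDF_le_of_nonpos h)
    rcases le_total x 2 with h' | h'
    · exact hmax ⟨h, h'⟩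
    · exact hx (sq_normalPDF_le_of_two_le h')
  · refine lt_of_le_of_lt ((div_sqrt_normalTail_le_iff (by norm_num)).2 (sq_normalPDF_le t)) ?_
    norm_num

/-! ### Events of probability tending to one and the weak law of large numbers. -/

/-- The law of `n + 1` independent standard normal variables. -/
def stdLaw (n : ℕ) : Measure (Fin (n + 1) → ℝ) := Measure.pi fun _ => gaussianReal 0 1

instance (n : ℕ) : IsProbabilityMeasure (stdLaw n) := by unfold stdLaw; infer_instance

/-- The events `E n` have probability tending to one. -/
def WHP (E : (n : ℕ) → Set (Fin (n + 1) → ℝ)) : Prop :=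
  Tendsto (fun n => stdLaw n (E n)ᶜ) atTop (𝓝 0)

lemma WHP.mono {E F : (n : ℕ) → Set (Fin (n + 1) → ℝ)} (hE : WHP E)
    (h : ∀ᶠ n in atTop, E n ⊆ F n) : WHP F :=
  tendsto_of_tendsto_of_tendsto_of_le_of_le' tendsto_const_nhds hE
    (Eventually.of_forall fun _ => zero_le)
    (h.mono fun _ hn => measure_mono (compl_subset_compl.2 hn))

lemma WHP.inter {E F : (n : ℕ) → Set (Fin (n + 1) → ℝ)} (hE : WHP E) (hF : WHP F) :
    WHP fun n => E n ∩ F n := by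
  have := hE.add hF
  rw [add_zero] at this
  refine tendsto_of_tendsto_of_tendsto_of_le_of_le tendsto_const_nhds this
    (fun _ => zero_le) fun n => ?_
  simp only [compl_inter]
  exact measure_union_le _ _

lemma WHP.biInter {ι : Type*} (s : Finset ι) {E : ι → (n : ℕ) → Set (Fin (n + 1) → ℝ)}
    (hE : ∀ i ∈ s, WHP (E i)) : WHP fun n => ⋂ i ∈ s, E i n := by
  have := tendsto_finsetSum s hE
  simp only [Finset.sum_const_zero] at this
  refine tendsto_of_tendsto_of_tendsto_of_le_of_le tendsto_const_nhds this
    (fun _ => zero_le) fun n => ?_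
  simp only [compl_iInter]
  exact measure_biUnion_finset_le _ _

/-- Only subadditivity is used, so the events need not be measurable; the one in `whp_mem_levelSet`
is quantified over all `c`. -/
lemma WHP.eventually_le {E : (n : ℕ) → Set (Fin (n + 1) → ℝ)} (hE : WHP E) {α : ℝ} (hα : 0 < α) :
    ∀ᶠ n in atTop, 1 - α < (stdLaw n).real (E n) := by
  filter_upwards [hE.eventually (gt_mem_nhds (ENNReal.ofReal_pos.2 hα))] with n hn
  have h1 : (stdLaw n).real (E n)ᶜ < α := by
    rw [Measure.real, ← ENNReal.toReal_ofReal hα.le]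
    exact ENNReal.toReal_strict_mono ENNReal.ofReal_ne_top hn
  have h2 := measureReal_union_le (μ := stdLaw n) (E n) (E n)ᶜ
  rw [union_compl_self, probReal_univ] at h2
  linarith

/-- Chebyshev's inequality: the variance of the sum grows like `n + 1`, the squared deviation like
`(n + 1)²`. -/
lemma whp_abs_sum_sub_lt {f : ℝ → ℝ} (hf : MemLp f 2 (gaussianReal 0 1)) {ε : ℝ} (hε : 0 < ε) :
    WHP fun n => {z | |∑ i, f (z i) - (n + 1) * ∫ x, f x ∂gaussianReal 0 1| < ε * (n + 1)} := by
  have hb : ∀ n : ℕ, stdLaw n {z | |∑ i, f (z i) - (n + 1) * ∫ x, f x ∂gaussianReal 0 1|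
      < ε * (n + 1)}ᶜ ≤
      ENNReal.ofReal (Var[f; gaussianReal 0 1] / ε ^ 2 * (1 / ((n : ℝ) + 1))) := by
    intro n
    have hmp : ∀ i : Fin (n + 1), MeasurePreserving (fun z : Fin (n + 1) → ℝ => z i) (stdLaw n)
        (gaussianReal 0 1) := fun i => measurePreserving_eval (fun _ => gaussianReal 0 1) i
    have hm : ∀ i : Fin (n + 1), MemLp (fun z : Fin (n + 1) → ℝ => f (z i)) 2 (stdLaw n) :=
      fun i => hf.comp_measurePreserving (hmp i)
    have hs : MemLp (∑ i, fun z : Fin (n + 1) → ℝ => f (z i)) 2 (stdLaw n) :=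
      memLp_finsetSum' _ fun i _ => hm i
    have hint : ∫ z, (∑ i, fun z : Fin (n + 1) → ℝ => f (z i)) z ∂stdLaw n =
        (n + 1) * ∫ x, f x ∂gaussianReal 0 1 := by
      simp only [Finset.sum_apply]
      rw [integral_finsetSum _ fun i _ => (hm i).integrable one_le_two]
      have : ∀ i : Fin (n + 1), ∫ z : Fin (n + 1) → ℝ, f (z i) ∂stdLaw n =
          ∫ x, f x ∂gaussianReal 0 1 := by
        intro i
        rw [← (hmp i).map_eq, integral_map (hmp i).aemeasurable]
        rw [(hmp i).map_eq]; exact hf.1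
      simp [this]
    have hvar : Var[∑ i, fun z : Fin (n + 1) → ℝ => f (z i); stdLaw n] =
        (n + 1) * Var[f; gaussianReal 0 1] := by
      have := variance_sum_pi (ι := Fin (n + 1)) (μ := fun _ => gaussianReal 0 1)
        (X := fun _ => f) fun _ => hf
      rw [stdLaw, this]
      simp
    have hc : 0 < ε * ((n : ℝ) + 1) := by positivity
    have := meas_ge_le_variance_div_sq hs hc
    rw [hint, hvar] at this
    convert this using 2
    · ext z; simp [Finset.sum_apply]
    · have : ((n : ℝ) + 1) ≠ 0 := by positivity
      field_simp
  refine tendsto_of_tendsto_of_tendsto_of_le_of_le tendsto_const_nhds ?_ (fun _ => zero_le) hb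
  rw [← ENNReal.ofReal_zero]
  refine (ENNReal.continuous_ofReal.tendsto _).comp ?_
  simpa using (tendsto_one_div_add_atTop_nhds_zero_nat (𝕜 := ℝ)).const_mul
    (Var[f; gaussianReal 0 1] / ε ^ 2)

lemma whp_abs_last_lt {ε : ℝ} (hε : 0 < ε) :
    WHP fun n => {z | |z (Fin.last n)| < ε * √((n : ℝ) + 1)} := by
  have hf : MemLp id 2 (gaussianReal 0 1) := memLp_id_gaussianReal 2
  have hb : ∀ n : ℕ, stdLaw n {z | |z (Fin.last n)| < ε * √((n : ℝ) + 1)}ᶜ ≤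
      ENNReal.ofReal (1 / ε ^ 2 * (1 / ((n : ℝ) + 1))) := by
    intro n
    have hmp : MeasurePreserving (fun z : Fin (n + 1) → ℝ => z (Fin.last n)) (stdLaw n)
        (gaussianReal 0 1) := measurePreserving_eval (fun _ => gaussianReal 0 1) _
    have hc : 0 < ε * √((n : ℝ) + 1) := by positivity
    have := meas_ge_le_variance_div_sq hf hc
    rw [variance_id_gaussianReal] at this
    have h2 : (gaussianReal 0 1) {x | |x| < ε * √((n : ℝ) + 1)}ᶜ ≤
        ENNReal.ofReal (1 / ε ^ 2 * (1 / ((n : ℝ) + 1))) := by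
      convert this using 2
      · ext z; simp
      · rw [mul_pow, Real.sq_sqrt (by positivity)]
        simp; ring
    rw [← hmp.measure_preimage
      (measurableSet_lt (by fun_prop) (by fun_prop)).compl.nullMeasurableSet] at h2
    exact h2
  refine tendsto_of_tendsto_of_tendsto_of_le_of_le tendsto_const_nhds ?_ (fun _ => zero_le) hb
  rw [← ENNReal.ofReal_zero]
  refine (ENNReal.continuous_ofReal.tendsto _).comp ?_
  simpa only [mul_zero] using
    (tendsto_one_div_add_atTop_nhds_zero_nat (𝕜 := ℝ)).const_mul (1 / ε ^ 2)

/-! ### Truncated Gaussian moments. -/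

lemma integral_Ioi_mul_normalPDF (t : ℝ) : ∫ x in Ioi t, x * normalPDF x = normalPDF t := by
  have hint : Integrable (fun x => x * normalPDF x) := by
    have := (memLp_id_gaussianReal (μ := 0) (v := 1) 1).integrable (by simp)
    rw [gaussianReal_of_var_ne_zero _ one_ne_zero,
      integrable_withDensity_iff_integrable_smul' (measurable_gaussianPDF _ _)
        (Eventually.of_forall fun x => gaussianPDF_lt_top)] at this
    refine this.congr (Eventually.of_forall fun x => ?_)
    simp [normalPDF, mul_comm]
  have := integral_Ioi_of_hasDerivAt_of_tendsto' (a := t) (f := fun x => -normalPDF x)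
    (f' := fun x => x * normalPDF x) (m := 0)
    (fun x _ => by convert! (hasDerivAt_normalPDF x).neg using 1; ring) hint.integrableOn
    (by simpa using tendsto_normalPDF_atTop.neg)
  simpa using this

lemma integral_indicator_gaussian {t : ℝ} (f : ℝ → ℝ) :
    ∫ x, (Ioi t).indicator f x ∂gaussianReal 0 1 = ∫ x in Ioi t, f x * normalPDF x := by
  rw [integral_gaussianReal_eq_integral_smul one_ne_zero, ← integral_indicator measurableSet_Ioi]
  congr 1
  ext x
  by_cases hx : x ∈ Ioi t
  · simp [hx, normalPDF, mul_comm]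
  · simp [hx]

lemma setIntegral_Ioi_normalPDF (t : ℝ) : ∫ x in Ioi t, normalPDF x = normalTail t := by
  rw [normalTail_eq_real, Measure.real, gaussianReal_apply_eq_integral _ one_ne_zero]
  exact (ENNReal.toReal_ofReal (setIntegral_nonneg measurableSet_Ioi
    fun x _ => (normalPDF_pos x).le)).symm

lemma memLp_indicator_Ioi_id (t : ℝ) :
    MemLp ((Ioi t).indicator fun x => x) 2 (gaussianReal 0 1) :=
  (memLp_id_gaussianReal 2).indicator measurableSet_Ioi

lemma memLp_indicator_Ioi_one (t : ℝ) :
    MemLp ((Ioi t).indicator fun _ => (1 : ℝ)) 2 (gaussianReal 0 1) :=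
  (memLp_const 1).indicator measurableSet_Ioi

lemma max_sub_zero_eq (t x : ℝ) : max (x - t) 0 =
    (Ioi t).indicator (fun x => x) x - t * (Ioi t).indicator (fun _ => (1 : ℝ)) x := by
  by_cases hx : x ∈ Ioi t
  · simp [hx, (sub_pos.2 (mem_Ioi.1 hx)).le]
  · simp only [indicator_of_notMem hx]
    rw [max_eq_right (by simpa using hx)]; simp

lemma memLp_max_sub_zero (t : ℝ) : MemLp (fun x => max (x - t) 0) 2 (gaussianReal 0 1) := by
  simp_rw [max_sub_zero_eq]
  exact (memLp_indicator_Ioi_id t).sub ((memLp_indicator_Ioi_one t).const_mul t)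

lemma integral_indicator_id (t : ℝ) :
    ∫ x, (Ioi t).indicator (fun x => x) x ∂gaussianReal 0 1 = normalPDF t := by
  rw [integral_indicator_gaussian, integral_Ioi_mul_normalPDF]

lemma integral_indicator_one (t : ℝ) :
    ∫ x, (Ioi t).indicator (fun _ => (1 : ℝ)) x ∂gaussianReal 0 1 = normalTail t := by
  rw [integral_indicator_gaussian]
  simp [setIntegral_Ioi_normalPDF]

lemma integral_max_sub_zero (t : ℝ) :
    ∫ x, max (x - t) 0 ∂gaussianReal 0 1 = normalPDF t - t * normalTail t := by
  simp_rw [max_sub_zero_eq]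
  rw [integral_sub ((memLp_indicator_Ioi_id t).integrable one_le_two)
    (((memLp_indicator_Ioi_one t).integrable one_le_two).const_mul t), integral_const_mul,
    integral_indicator_id, integral_indicator_one]

lemma measurePreserving_neg_gaussian :
    MeasurePreserving (fun x : ℝ => -x) (gaussianReal 0 1) (gaussianReal 0 1) :=
  ⟨measurable_neg, by simpa using gaussianReal_map_neg (μ := 0) (v := 1)⟩

/-- The eighth moment is finite, as Chebyshev's inequality for sums of fourth powers requires. -/
lemma memLp_pow_four : MemLp (fun x : ℝ => x ^ 4) 2 (gaussianReal 0 1) := by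
  rw [memLp_two_iff_integrable_sq (by fun_prop)]
  have := integrable_pow_of_integrable_exp_mul (X := id) (μ := gaussianReal 0 1) one_ne_zero
    (integrable_exp_mul_gaussianReal 1) (integrable_exp_mul_gaussianReal (-1)) 8
  refine this.congr (Eventually.of_forall fun x => ?_)
  simp [← pow_mul]

/-! ### Linear algebra of the design and the explicit statistic. -/

lemma linearIndependent_controlDesign {n : ℕ} {c : ℝ} (h : (n : ℝ) * c ^ 2 < 1) :
    LinearIndependent ℝ (controlDesign n c).col := by
  have hd : √(1 - (n : ℝ) * c ^ 2) ≠ 0 := (Real.sqrt_pos.2 (by linarith)).ne'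
  rw [← Matrix.mulVec_injective_iff, ← Matrix.coe_mulVecLin, ← LinearMap.ker_eq_bot,
    LinearMap.ker_eq_bot']
  intro w hw
  have hrow : ∀ i, ∑ j, controlDesign n c i j * w j = 0 := fun i => congrFun hw i
  have hne : ∀ i : Fin n, Fin.last n ≠ i.castSucc := fun i => (Fin.castSucc_lt_last i).ne'
  have hlast : w (Fin.last n) = 0 := by
    have := hrow (Fin.last n)
    rw [Fin.sum_univ_castSucc] at this
    simpa [controlDesign, hne, (hne _).symm, hd] using this
  funext i
  refine Fin.lastCases hlast (fun i => ?_) i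
  have := hrow i.castSucc
  rw [Fin.sum_univ_castSucc] at this
  simpa [controlDesign, (hne _).symm, hlast] using this

lemma mulVec_subdesign_injective {n : ℕ} {c : ℝ} (h : (n : ℝ) * c ^ 2 < 1)
    (M : Finset (Fin (n + 1))) :
    Function.Injective (subdesign (controlDesign n c) M).mulVec := by
  rw [Matrix.mulVec_injective_iff]
  exact (linearIndependent_controlDesign h).comp _ Subtype.val_injective

lemma mem_allModels_controlDesign {n : ℕ} {c : ℝ} (h : (n : ℝ) * c ^ 2 < 1)
    (M : Finset (Fin (n + 1))) : M ∈ allModels (controlDesign n c) := by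
  have := mulVec_subdesign_injective h M
  rw [← Matrix.coe_mulVecLin] at this
  rw [allModels, mem_ofPred_eq, Matrix.rank, LinearMap.finrank_range_of_inj this]
  simp

lemma gram_det_ne_zero {n : ℕ} {c : ℝ} (h : (n : ℝ) * c ^ 2 < 1)
    (M : Finset (Fin (n + 1))) :
    ((subdesign (controlDesign n c) M).transpose * subdesign (controlDesign n c) M).det ≠ 0 := by
  rw [Ne, ← Matrix.exists_mulVec_eq_zero_iff]
  rintro ⟨v, hv, h0⟩
  apply hv
  have hker : v ∈ LinearMap.ker ((subdesign (controlDesign n c) M).transpose *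
      subdesign (controlDesign n c) M).mulVecLin := h0
  rw [Matrix.ker_mulVecLin_transpose_mul_self] at hker
  exact mulVec_subdesign_injective h M (by simpa using hker)

/-- The residual of the primary predictor after projection on the controls in `M`. -/
def primaryResidual (n : ℕ) (c : ℝ) (M : Finset (Fin (n + 1))) (i : Fin (n + 1)) : ℝ :=
  if i = Fin.last n then √(1 - (n : ℝ) * c ^ 2) else if i ∈ M then 0 else c

/-- The coefficients of the residual of the primary predictor in the columns of `M`. -/
def residualCoeff (n : ℕ) (c : ℝ) (M : Finset (Fin (n + 1))) (j : M) : ℝ :=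
  if (j : Fin (n + 1)) = Fin.last n then 1 else -c

lemma subdesign_mulVec_residualCoeff {n : ℕ} {c : ℝ} {M : Finset (Fin (n + 1))}
    (hM : Fin.last n ∈ M) :
    (subdesign (controlDesign n c) M).mulVec (residualCoeff n c M) = primaryResidual n c M := by
  funext i
  have : (subdesign (controlDesign n c) M).mulVec (residualCoeff n c M) i =
      ∑ j ∈ M, controlDesign n c i j * (if j = Fin.last n then 1 else -c) :=
    Finset.sum_coe_sort M fun j => controlDesign n c i j * (if j = Fin.last n then 1 else -c)
  rw [this, ← Finset.add_sum_erase _ _ hM]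
  have : ∑ j ∈ M.erase (Fin.last n), controlDesign n c i j * (if j = Fin.last n then 1 else -c) =
      ∑ j ∈ M.erase (Fin.last n), if i = j then -c else 0 := by
    refine Finset.sum_congr rfl fun j hj => ?_
    by_cases hij : i = j <;> simp [controlDesign, Finset.ne_of_mem_erase hj, hij]
  rw [this, Finset.sum_ite_eq]
  by_cases hi : i = Fin.last n
  · simp [controlDesign, primaryResidual, hi]
  · by_cases hiM : i ∈ M <;> simp [controlDesign, primaryResidual, hi, hiM]

lemma primaryResidual_dotProduct {n : ℕ} {c : ℝ} {M : Finset (Fin (n + 1))}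
    (hM : Fin.last n ∈ M) (y : Fin (n + 1) → ℝ) :
    primaryResidual n c M ⬝ᵥ y =
      √(1 - (n : ℝ) * c ^ 2) * y (Fin.last n) + c * ∑ i ∈ Mᶜ, y i := by
  rw [dotProduct, ← Finset.sum_add_sum_compl M, Finset.mul_sum]
  congr 1
  · rw [Finset.sum_eq_single_of_mem _ hM]
    · simp [primaryResidual]
    · intro i hi hne
      simp [primaryResidual, hi, hne]
  · refine Finset.sum_congr rfl fun i hi => ?_
    have hi' := Finset.mem_compl.1 hi
    have : i ≠ Fin.last n := fun h => hi' (h ▸ hM)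
    simp [primaryResidual, hi', this]

/-- The squared norm of the residual of the primary predictor when `k` controls are left out. -/
def residualSq (n : ℕ) (c : ℝ) (k : ℕ) : ℝ := 1 - (n : ℝ) * c ^ 2 + c ^ 2 * k

lemma residualSq_pos {n : ℕ} {c : ℝ} (h : (n : ℝ) * c ^ 2 < 1) (k : ℕ) : 0 < residualSq n c k := by
  have : 0 ≤ c ^ 2 * k := by positivity
  rw [residualSq]; linarith

/-- The residual is orthogonal to the controls in `M`, and its product with the primary predictor is
its squared norm. This yields the needed column of the inverse Gram matrix without inverting it. -/
lemma gram_mulVec_residualCoeff {n : ℕ} {c : ℝ} (h : (n : ℝ) * c ^ 2 < 1)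
    {M : Finset (Fin (n + 1))} (hM : Fin.last n ∈ M) :
    ((subdesign (controlDesign n c) M).transpose * subdesign (controlDesign n c) M).mulVec
      (residualCoeff n c M) = Pi.single ⟨Fin.last n, hM⟩ (residualSq n c Mᶜ.card) := by
  rw [← Matrix.mulVec_mulVec, subdesign_mulVec_residualCoeff hM]
  funext j
  have : (subdesign (controlDesign n c) M).transpose.mulVec (primaryResidual n c M) j =
      primaryResidual n c M ⬝ᵥ fun i => controlDesign n c i j := by
    rw [dotProduct_comm]; rfl
  rw [this, primaryResidual_dotProduct hM]
  obtain ⟨j, hj⟩ := j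
  by_cases hl : j = Fin.last n
  · subst hl
    have : ∑ i ∈ Mᶜ, controlDesign n c i (Fin.last n) = ∑ i ∈ Mᶜ, c := by
      refine Finset.sum_congr rfl fun i hi => ?_
      have : i ≠ Fin.last n := fun h => Finset.mem_compl.1 hi (h ▸ hM)
      simp [controlDesign, this]
    simp only [this, Finset.sum_const, nsmul_eq_mul, Pi.single_eq_same]
    rw [controlDesign]
    simp only [if_true, residualSq]
    rw [Real.mul_self_sqrt (by linarith)]
    ring
  · rw [Pi.single_eq_of_ne (by simpa using hl)]
    have : ∑ i ∈ Mᶜ, controlDesign n c i j = 0 := by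
      refine Finset.sum_eq_zero fun i hi => ?_
      have : i ≠ j := fun h => Finset.mem_compl.1 hi (h ▸ hj)
      simp [controlDesign, this, hl]
    simp only [this]
    simp [controlDesign, hl, Ne.symm hl]

lemma gram_inv_last_row {n : ℕ} {c : ℝ} (h : (n : ℝ) * c ^ 2 < 1)
    {M : Finset (Fin (n + 1))} (hM : Fin.last n ∈ M) (j : M) :
    ((subdesign (controlDesign n c) M).transpose * subdesign (controlDesign n c) M)⁻¹
      ⟨Fin.last n, hM⟩ j = residualCoeff n c M j / residualSq n c Mᶜ.card := by
  set G := (subdesign (controlDesign n c) M).transpose * subdesign (controlDesign n c) M with hG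
  have hdet : IsUnit G.det := (gram_det_ne_zero h M).isUnit
  have hsymm : G⁻¹.transpose = G⁻¹ := by
    rw [Matrix.transpose_nonsing_inv, hG, Matrix.transpose_mul, Matrix.transpose_transpose]
  have hv : G⁻¹.mulVec (G.mulVec (residualCoeff n c M)) = residualCoeff n c M := by
    rw [Matrix.mulVec_mulVec, Matrix.nonsing_inv_mul _ hdet, Matrix.one_mulVec]
  rw [gram_mulVec_residualCoeff h hM, Matrix.mulVec_single] at hv
  have h1 : G⁻¹ ⟨Fin.last n, hM⟩ j = G⁻¹ j ⟨Fin.last n, hM⟩ := congrFun (congrFun hsymm j) _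
  rw [eq_div_iff (residualSq_pos h _).ne', ← congrFun hv j, h1]
  simp

lemma lsCoeff_last {n : ℕ} {c : ℝ} (h : (n : ℝ) * c ^ 2 < 1)
    {M : Finset (Fin (n + 1))} (hM : Fin.last n ∈ M) (y : Fin (n + 1) → ℝ) :
    lsCoeff (controlDesign n c) M y ⟨Fin.last n, hM⟩ =
      (√(1 - (n : ℝ) * c ^ 2) * y (Fin.last n) + c * ∑ i ∈ Mᶜ, y i) /
        residualSq n c Mᶜ.card := by
  rw [lsCoeff, ← Matrix.mulVec_mulVec, Matrix.mulVec]
  have : (fun j => ((subdesign (controlDesign n c) M).transpose *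
      subdesign (controlDesign n c) M)⁻¹ ⟨Fin.last n, hM⟩ j) =
      (residualSq n c Mᶜ.card)⁻¹ • residualCoeff n c M := by
    funext j
    rw [gram_inv_last_row h hM]
    simp [div_eq_inv_mul]
  rw [this, smul_dotProduct, Matrix.dotProduct_mulVec, Matrix.vecMul_transpose,
    subdesign_mulVec_residualCoeff hM, primaryResidual_dotProduct hM, smul_eq_mul, div_eq_inv_mul]

lemma tStat_last {n : ℕ} {c : ℝ} (h : (n : ℝ) * c ^ 2 < 1) {M : Finset (Fin (n + 1))}
    (hM : Fin.last n ∈ M) (m y : Fin (n + 1) → ℝ) {s : ℝ} (hs : 0 < s) :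
    tStat (controlDesign n c) M ⟨Fin.last n, hM⟩ m s y =
      (√(1 - (n : ℝ) * c ^ 2) * ((y (Fin.last n) - m (Fin.last n)) / s) +
        c * ∑ i ∈ Mᶜ, (y i - m i) / s) / √(residualSq n c Mᶜ.card) := by
  have hR := residualSq_pos h Mᶜ.card
  have hR' := Real.sqrt_pos.2 hR
  rw [tStat, lsCoeff_last h, lsCoeff_last h, gram_inv_last_row h]
  simp only [residualCoeff, if_true]
  rw [← Finset.sum_div, Finset.sum_sub_distrib, Real.sqrt_div zero_le_one, Real.sqrt_one]
  have hR2 := Real.mul_self_sqrt hR.le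
  generalize √(residualSq n c Mᶜ.card) = r at hR' hR2
  rw [← hR2]
  field_simp
  ring

/-! ### Level sets and existence of the minimal level. -/

/-- The normalized responses for which all `|t|`-statistics of the primary predictor are at most
`K`; `A` is the set of left out controls. -/
def levelSet (n : ℕ) (c K : ℝ) : Set (Fin (n + 1) → ℝ) :=
  {z | ∀ A : Finset (Fin (n + 1)), Fin.last n ∉ A →
    |√(1 - (n : ℝ) * c ^ 2) * z (Fin.last n) + c * ∑ i ∈ A, z i| ≤ K * √(residualSq n c A.card)}

lemma isClosed_levelSet (n : ℕ) (c K : ℝ) : IsClosed (levelSet n c K) := by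
  have : levelSet n c K = ⋂ A : Finset (Fin (n + 1)), ⋂ _ : Fin.last n ∉ A,
      {z | |√(1 - (n : ℝ) * c ^ 2) * z (Fin.last n) + c * ∑ i ∈ A, z i| ≤
        K * √(residualSq n c A.card)} := by
    ext z; simp [levelSet]
  rw [this]
  exact isClosed_iInter fun A => isClosed_iInter fun _ =>
    isClosed_le (by fun_prop) continuous_const

lemma map_responseLaw {n : ℕ} (m : Fin (n + 1) → ℝ) {s : ℝ} (hs : 0 < s) :
    (responseLaw m s).map (fun y i => (y i - m i) / s) = stdLaw n := by
  have hg : ∀ i, (gaussianReal (m i) (Real.toNNReal (s ^ 2))).map (fun x => (x - m i) / s) =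
      gaussianReal 0 1 := by
    intro i
    have : (fun x => (x - m i) / s) = (fun x => x / s) ∘ fun x => x - m i := rfl
    rw [this, ← Measure.map_map (by fun_prop) (by fun_prop), gaussianReal_map_sub_const,
      gaussianReal_map_div_const]
    congr 1
    · simp
    · ext
      have : s ≠ 0 := hs.ne'
      simp [sq_nonneg, this]
  rw [responseLaw, Measure.pi_map_pi (f := fun i (x : ℝ) => (x - m i) / s)
    (hμ := fun i => by rw [hg i]; infer_instance) fun i => by fun_prop]
  simp_rw [hg]
  rfl

/-- Standardization carries the response law to `stdLaw n`, so mean and variance drop out; submodels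
correspond to complements `A` of left out controls. -/
lemma posi1Levels_eq {n : ℕ} {c : ℝ} (h : (n : ℝ) * c ^ 2 < 1) (α : ℝ) (m : Fin (n + 1) → ℝ)
    {s : ℝ} (hs : 0 < s) :
    posi1Levels (controlDesign n c) (allModels (controlDesign n c)) (Fin.last n) α m s =
      {K | 1 - α ≤ (stdLaw n).real (levelSet n c K)} := by
  ext K
  have : {y | ∀ (M : Finset (Fin (n + 1)))
      (h : M ∈ modelsContaining (allModels (controlDesign n c)) (Fin.last n)),
      |tStat (controlDesign n c) M ⟨Fin.last n, h.1⟩ m s y| ≤ K} =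
      (fun y i => (y i - m i) / s) ⁻¹' levelSet n c K := by
    ext y
    simp only [mem_ofPred_eq, mem_preimage, levelSet]
    constructor
    · intro hy A hA
      have := hy Aᶜ ⟨by simpa using hA, mem_allModels_controlDesign h _⟩
      rwa [tStat_last h (by simpa using hA) m y hs, abs_div, abs_of_nonneg (Real.sqrt_nonneg _),
        div_le_iff₀ (Real.sqrt_pos.2 (residualSq_pos h _)), compl_compl] at this
    · intro hy M hM
      have := hy Mᶜ (by simpa using hM.1)
      rwa [tStat_last h hM.1 m y hs, abs_div, abs_of_nonneg (Real.sqrt_nonneg _),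
        div_le_iff₀ (Real.sqrt_pos.2 (residualSq_pos h _))]
  rw [posi1Levels, mem_ofPred_eq, mem_ofPred_eq, this, ← map_responseLaw m hs,
    map_measureReal_apply (by fun_prop) (isClosed_levelSet n c K).measurableSet]

lemma levelSet_mono {n : ℕ} {c K K' : ℝ} (h : K ≤ K') : levelSet n c K ⊆ levelSet n c K' :=
  fun _ hz A hA => (hz A hA).trans (mul_le_mul_of_nonneg_right h (Real.sqrt_nonneg _))

lemma nonneg_of_levelSet_nonempty {n : ℕ} {c K : ℝ} (h : (n : ℝ) * c ^ 2 < 1)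
    (hK : (levelSet n c K).Nonempty) : 0 ≤ K := by
  obtain ⟨z, hz⟩ := hK
  have := (abs_nonneg _).trans (hz ∅ (by simp))
  exact nonneg_of_mul_nonneg_left this (Real.sqrt_pos.2 (residualSq_pos h _))

/-- The euclidean ball of radius `K` lies in every level set. -/
lemma ball_subset_levelSet {n : ℕ} {c K : ℝ} (h : (n : ℝ) * c ^ 2 < 1) (hK : 0 ≤ K) :
    {z : Fin (n + 1) → ℝ | ∑ i, z i ^ 2 ≤ K ^ 2} ⊆ levelSet n c K := by
  intro z hz A hA
  have hM : Fin.last n ∈ Aᶜ := by simpa using hA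
  have hdot : ∀ y, primaryResidual n c Aᶜ ⬝ᵥ y =
      √(1 - (n : ℝ) * c ^ 2) * y (Fin.last n) + c * ∑ i ∈ A, y i := fun y => by
    rw [primaryResidual_dotProduct hM, compl_compl]
  have hsq : ∑ i, primaryResidual n c Aᶜ i ^ 2 = residualSq n c A.card := by
    have : ∑ i, primaryResidual n c Aᶜ i ^ 2 =
        primaryResidual n c Aᶜ ⬝ᵥ primaryResidual n c Aᶜ := by simp [dotProduct, sq]
    have h2 : ∑ i ∈ A, primaryResidual n c Aᶜ i = ∑ i ∈ A, c := by
      refine Finset.sum_congr rfl fun i hi => ?_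
      have : i ≠ Fin.last n := fun h => hA (h ▸ hi)
      simp [primaryResidual, this, hi]
    rw [this, hdot, h2]
    simp only [primaryResidual, if_true, Finset.sum_const, nsmul_eq_mul, residualSq]
    rw [Real.mul_self_sqrt (by linarith)]
    ring
  rw [← hdot]
  refine abs_le_of_sq_le_sq ?_ (by positivity)
  rw [mul_pow, Real.sq_sqrt (residualSq_pos h _).le, ← hsq, dotProduct]
  refine (Finset.sum_mul_sq_le_sq_mul_sq _ _ _).trans ?_
  rw [mul_comm]
  exact mul_le_mul_of_nonneg_right hz (Finset.sum_nonneg fun i _ => sq_nonneg _)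

/-- The balls of `ball_subset_levelSet` do not depend on `c`, so one radius serves all `c`; hence
the supremum over `c` is finite. -/
lemma exists_uniform_level (n : ℕ) {α : ℝ} (hα : 0 < α) :
    ∃ K, ∀ c : ℝ, (n : ℝ) * c ^ 2 < 1 → 1 - α ≤ (stdLaw n).real (levelSet n c K) := by
  let B : ℕ → Set (Fin (n + 1) → ℝ) := fun k => {z | ∑ i, z i ^ 2 ≤ (k : ℝ) ^ 2}
  have hmono : Monotone B := fun a b hab z hz => le_trans (show _ ≤ (a : ℝ) ^ 2 from hz) (by gcongr)
  have huniv : ⋃ k, B k = univ := by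
    refine eq_univ_of_forall fun z => mem_iUnion.2 ?_
    obtain ⟨k, hk⟩ := exists_nat_ge (∑ i, z i ^ 2)
    refine ⟨k, show _ ≤ (k : ℝ) ^ 2 from hk.trans ?_⟩
    exact_mod_cast Nat.le_self_pow two_ne_zero k
  have ht : Tendsto (fun k => (stdLaw n).real (B k)) atTop (𝓝 1) := by
    have := tendsto_measure_iUnion_atTop (μ := stdLaw n) hmono
    rw [huniv, measure_univ] at this
    exact (ENNReal.tendsto_toReal ENNReal.one_ne_top).comp this
  obtain ⟨k, hk⟩ := (ht.eventually (lt_mem_nhds (by linarith : 1 - α < 1))).exists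
  exact ⟨k, fun c hc => hk.le.trans (measureReal_mono (ball_subset_levelSet hc k.cast_nonneg))⟩

/-- Continuity of the measure from above along levels decreasing to the infimum: the inequalities
are non-strict, so the level sets intersect in the level set of the limit. -/
lemma isLeast_levels {n : ℕ} {c : ℝ} (h : (n : ℝ) * c ^ 2 < 1) {α : ℝ} (hα0 : 0 < α)
    (hα1 : α < 1) :
    IsLeast {K | 1 - α ≤ (stdLaw n).real (levelSet n c K)}
      (sInf {K | 1 - α ≤ (stdLaw n).real (levelSet n c K)}) := by
  set S := {K | 1 - α ≤ (stdLaw n).real (levelSet n c K)} with hS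
  have hbdd : BddBelow S := by
    refine ⟨0, fun K hK => nonneg_of_levelSet_nonempty h ?_⟩
    rw [nonempty_iff_ne_empty]
    rintro h0
    rw [hS, mem_ofPred_eq, h0, measureReal_empty] at hK
    linarith
  have hne : S.Nonempty := (exists_uniform_level n hα0).imp fun K hK => hK c h
  refine ⟨?_, fun K hK => csInf_le hbdd hK⟩
  let u : ℕ → ℝ := fun k => sInf S + 1 / ((k : ℝ) + 1)
  have hu : ∀ k, u k ∈ S := by
    intro k
    obtain ⟨K, hK, hlt⟩ := exists_lt_of_csInf_lt hne
      (lt_add_of_pos_right (sInf S) (Nat.one_div_pos_of_nat (α := ℝ) (n := k)))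
    exact le_trans hK (measureReal_mono (levelSet_mono hlt.le))
  have hlim : Tendsto u atTop (𝓝 (sInf S)) := by
    simpa only [add_zero] using
      (tendsto_one_div_add_atTop_nhds_zero_nat (𝕜 := ℝ)).const_add (sInf S)
  have hanti : Antitone fun k => levelSet n c (u k) := fun a b hab =>
    levelSet_mono (add_le_add_right (Nat.one_div_le_one_div hab) _)
  have hinter : ⋂ k, levelSet n c (u k) = levelSet n c (sInf S) := by
    refine subset_antisymm (fun z hz A hA => ?_) (subset_iInter fun k => levelSet_mono ?_)
    · exact ge_of_tendsto' (hlim.mul_const _) fun k => mem_iInter.1 hz k A hA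
    · simp only [u]; linarith [Nat.one_div_pos_of_nat (α := ℝ) (n := k)]
  have ht : Tendsto (fun k => (stdLaw n).real (levelSet n c (u k))) atTop
      (𝓝 ((stdLaw n).real (levelSet n c (sInf S)))) := by
    have := tendsto_measure_iInter_atTop (μ := stdLaw n)
      (fun k => (isClosed_levelSet n c (u k)).nullMeasurableSet) hanti ⟨0, measure_ne_top _ _⟩
    rw [hinter] at this
    exact (ENNReal.tendsto_toReal (measure_ne_top _ _)).comp this
  exact ge_of_tendsto' ht hu

/-! ### Upper bound, uniform in the submodel and in `c`. -/

lemma integral_comp_of_measurePreserving {g : ℝ ≃ᵐ ℝ}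
    (hg : MeasurePreserving g (gaussianReal 0 1) (gaussianReal 0 1)) (f : ℝ → ℝ) :
    ∫ x, f (g x) ∂gaussianReal 0 1 = ∫ x, f x ∂gaussianReal 0 1 :=
  hg.integral_comp g.measurableEmbedding f

/-- Here `x` stands for `|A|/p`, the first entry of a pair for the threshold, the second for the
error allowed in the law of large numbers. The threshold with tail `x` works at `x`, hence near `x`
since the inequality is strict; compactness leaves finitely many pairs. -/
lemma exists_finite_grid {L ε δ : ℝ} (hL : 0.6363 ≤ L)
    (hrate : ∀ t, normalPDF t ≤ L * √(normalTail t)) (hε : 0 < ε) (hδ : 0 < δ) :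
    ∃ s : Finset (ℝ × Ioi (0 : ℝ)), ∀ x ∈ Icc δ 1, ∃ p ∈ s,
      normalPDF p.1 - p.1 * normalTail p.1 + p.2 + p.1 * x < (L + ε) * √x := by
  let U : ℝ × Ioi (0 : ℝ) → Set ℝ := fun p =>
    {x | normalPDF p.1 - p.1 * normalTail p.1 + p.2 + p.1 * x < (L + ε) * √x}
  have hU : ∀ p, IsOpen (U p) := fun p => isOpen_lt (by fun_prop) (by fun_prop)
  have hcover : Icc δ 1 ⊆ ⋃ p, U p := by
    intro x hx
    have hx0 : 0 < x := hδ.trans_le hx.1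
    rw [mem_iUnion]
    rcases hx.2.lt_or_eq with h1 | rfl
    · obtain ⟨t, ht⟩ := exists_cdf_eq (r := 1 - x) ⟨by linarith, by linarith⟩
      have hs : 0 < √x := Real.sqrt_pos.2 hx0
      have htail : normalTail t = x := by rw [normalTail, ht]; ring
      refine ⟨⟨t, ε * √x / 2, by simp; positivity⟩, ?_⟩
      have h := hrate t
      rw [htail] at h
      change normalPDF t - t * normalTail t + ε * √x / 2 + t * x < (L + ε) * √x
      rw [htail]
      nlinarith [mul_pos hε hs]
    -- No threshold has tail 1, but `t = 0` suffices because `φ(0) < 0.6363 ≤ L`.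
    · refine ⟨⟨0, ε, hε⟩, ?_⟩
      change normalPDF 0 - 0 * normalTail 0 + ε + 0 * 1 < (L + ε) * √1
      have := normalPDF_le 0
      rw [Real.sqrt_one]
      linarith
  obtain ⟨s, hs⟩ := isCompact_Icc.elim_finite_subcover U hU hcover
  exact ⟨s, fun x hx => by simpa [U] using hs hx⟩

/-- Cauchy–Schwarz twice gives `(∑_A w)⁴ ≤ |A|³ ∑ w⁴`. Second moments alone would give only `√N
√|A|`; the fourth gain a factor `(|A|/N)^{1/4}`, which is small for small `A`. -/
lemma sum_le_of_sum_pow_four_le {ι : Type*} [Fintype ι] {A : Finset ι} {w : ι → ℝ} {D L N : ℝ}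
    (hL : 0 ≤ L) (hN : 0 ≤ N) (hw : ∑ i, w i ^ 4 ≤ D * N)
    (hA : D * A.card ≤ L ^ 4 * N) : ∑ i ∈ A, w i ≤ L * (√N * √(A.card : ℝ)) := by
  have h2 : (∑ i ∈ A, w i) ^ 2 ≤ A.card * ∑ i ∈ A, w i ^ 2 := sq_sum_le_card_mul_sum_sq
  have h3 : (∑ i ∈ A, w i ^ 2) ^ 2 ≤ A.card * ∑ i ∈ A, w i ^ 4 := by
    refine sq_sum_le_card_mul_sum_sq.trans_eq ?_
    simp only [← pow_mul]
  have h5 : ∑ i ∈ A, w i ^ 4 ≤ ∑ i, w i ^ 4 :=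
    Finset.sum_le_univ_sum_of_nonneg fun i => by positivity
  have h6 : (∑ i ∈ A, w i) ^ 4 ≤ (L * (√N * √(A.card : ℝ))) ^ 4 := by
    calc (∑ i ∈ A, w i) ^ 4 = ((∑ i ∈ A, w i) ^ 2) ^ 2 := by ring
      _ ≤ (A.card * ∑ i ∈ A, w i ^ 2) ^ 2 := by gcongr
      _ = A.card ^ 2 * (∑ i ∈ A, w i ^ 2) ^ 2 := by ring
      _ ≤ A.card ^ 2 * (A.card * (D * N)) :=
        mul_le_mul_of_nonneg_left
          (h3.trans (mul_le_mul_of_nonneg_left (h5.trans hw) (Nat.cast_nonneg _))) (by positivity)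
      _ = A.card ^ 2 * N * (D * A.card) := by ring
      _ ≤ A.card ^ 2 * N * (L ^ 4 * N) := by gcongr
      _ = L ^ 4 * (N ^ 2 * (A.card : ℝ) ^ 2) := by ring
      _ = L ^ 4 * ((√N ^ 2) ^ 2 * (√(A.card : ℝ) ^ 2) ^ 2) := by
        rw [Real.sq_sqrt hN, Real.sq_sqrt (Nat.cast_nonneg _)]
      _ = _ := by ring
  refine le_of_abs_le ((pow_le_pow_iff_left₀ (abs_nonneg _) (by positivity) four_ne_zero).1 ?_)
  rwa [Even.pow_abs (by decide)]

lemma mul_sqrt_div_self {N : ℝ} (hN : 0 < N) (k : ℕ) : N * √((k : ℝ) / N) = √N * √(k : ℝ) := by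
  rw [Real.sqrt_div (Nat.cast_nonneg _)]
  nth_rw 1 [← Real.mul_self_sqrt hN.le]
  have := Real.sqrt_pos.2 hN
  field_simp

lemma sum_le_sum_max_sub_zero {ι : Type*} [Fintype ι] (A : Finset ι) (w : ι → ℝ) (t : ℝ) :
    ∑ i ∈ A, w i ≤ ∑ i, max (w i - t) 0 + t * A.card := by
  calc ∑ i ∈ A, w i ≤ ∑ i ∈ A, (max (w i - t) 0 + t) :=
        Finset.sum_le_sum fun i _ => by linarith [le_max_left (w i - t) 0]
    _ = ∑ i ∈ A, max (w i - t) 0 + t * A.card := by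
      rw [Finset.sum_add_distrib, Finset.sum_const, nsmul_eq_mul, mul_comm t]
    _ ≤ _ := by
      have : ∑ i ∈ A, max (w i - t) 0 ≤ ∑ i, max (w i - t) 0 :=
        Finset.sum_le_univ_sum_of_nonneg fun i => le_max_right _ _
      linarith

/-- The map `g` will be the identity or negation, giving both signs of the sum. -/
lemma whp_sum_le {g : ℝ ≃ᵐ ℝ}
    (hg : MeasurePreserving g (gaussianReal 0 1) (gaussianReal 0 1)) {L ε : ℝ} (hL : 0.6363 ≤ L)
    (hrate : ∀ t, normalPDF t ≤ L * √(normalTail t)) (hε : 0 < ε) :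
    WHP fun n => {z | ∀ A : Finset (Fin (n + 1)),
      ∑ i ∈ A, g (z i) ≤ (L + ε) * (√((n : ℝ) + 1) * √(A.card : ℝ))} := by
  set C : ℝ := ∫ x, x ^ 4 ∂gaussianReal 0 1 with hC
  have hC0 : 0 ≤ C := integral_nonneg fun x => by positivity
  have hL0 : 0 < L := by linarith
  have hδ : 0 < L ^ 4 / (C + 1) := by positivity
  obtain ⟨s, hs⟩ := exists_finite_grid hL hrate hε hδ
  have h4 := whp_abs_sum_sub_lt (memLp_pow_four.comp_measurePreserving hg) one_pos
  have hgrid := WHP.biInter s fun p _ => whp_abs_sum_sub_lt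
    ((memLp_max_sub_zero p.1).comp_measurePreserving hg) p.2.2
  refine (h4.inter hgrid).mono (Eventually.of_forall fun n z hz A => ?_)
  have hN : (0 : ℝ) < n + 1 := by positivity
  have hcard : (A.card : ℝ) ≤ n + 1 := by
    exact_mod_cast (Finset.card_le_univ A).trans_eq (Fintype.card_fin _)
  obtain ⟨hz4, hzs⟩ := hz
  -- The cutoff is exactly what `sum_le_of_sum_pow_four_le` needs with `D = C + 1`; larger `A` fall
  -- in the range of the grid.
  rcases le_total (A.card : ℝ) (L ^ 4 / (C + 1) * (n + 1)) with hk | hk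
  · have h1 : ∑ i, g (z i) ^ 4 ≤ (C + 1) * (n + 1) := by
      rw [mem_ofPred_eq] at hz4
      have := (abs_lt.1 hz4).2
      simp only [Function.comp_apply] at this
      rw [integral_comp_of_measurePreserving hg fun x => x ^ 4, ← hC] at this
      linarith
    refine (sum_le_of_sum_pow_four_le (D := C + 1) hL0.le hN.le h1 ?_).trans
      (mul_le_mul_of_nonneg_right (by linarith) (by positivity))
    rw [div_mul_eq_mul_div, le_div_iff₀ (by positivity)] at hk
    linarith
  · have hx : (A.card : ℝ) / (n + 1) ∈ Icc (L ^ 4 / (C + 1)) 1 :=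
      ⟨(le_div_iff₀ hN).2 hk, (div_le_one hN).2 hcard⟩
    obtain ⟨p, hp, hlt⟩ := hs _ hx
    have h1 := mem_iInter₂.1 hzs p hp
    rw [mem_ofPred_eq] at h1
    replace h1 := (abs_lt.1 h1).2
    simp only [Function.comp_apply] at h1
    rw [integral_comp_of_measurePreserving hg fun x => max (x - p.1) 0,
      integral_max_sub_zero] at h1
    have h2 := sum_le_sum_max_sub_zero A (fun i => g (z i)) p.1
    rw [← mul_sqrt_div_self hN]
    have h4 := mul_lt_mul_of_pos_left hlt hN
    have h5 : ((n : ℝ) + 1) * (p.1 * ((A.card : ℝ) / (n + 1))) = p.1 * A.card := by field_simp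
    nlinarith

lemma whp_mem_levelSet {L ε : ℝ} (hL : 0.6363 ≤ L)
    (hrate : ∀ t, normalPDF t ≤ L * √(normalTail t)) (hε : 0 < ε) :
    WHP fun n => {z | ∀ c : ℝ, (n : ℝ) * c ^ 2 < 1 →
      z ∈ levelSet n c ((L + ε) * √((n : ℝ) + 1))} := by
  have h1 := whp_sum_le (g := MeasurableEquiv.refl ℝ) (MeasurePreserving.id _) hL hrate
    (half_pos hε)
  have h2 := whp_sum_le (g := MeasurableEquiv.neg ℝ) measurePreserving_neg_gaussian hL hrate
    (half_pos hε)
  have h3 := whp_abs_last_lt (half_pos hε)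
  refine ((h1.inter h2).inter h3).mono (Eventually.of_forall fun n z hz c hc A _ => ?_)
  obtain ⟨⟨hz1, hz2⟩, hz3⟩ := hz
  have hz1 : ∑ i ∈ A, z i ≤ _ := hz1 A
  have hz2 : ∑ i ∈ A, -z i ≤ _ := hz2 A
  have hz3 : |z (Fin.last n)| < _ := hz3
  rw [Finset.sum_neg_distrib] at hz2
  have hS : |∑ i ∈ A, z i| ≤ (L + ε / 2) * (√((n : ℝ) + 1) * √(A.card : ℝ)) :=
    abs_le.2 ⟨by linarith, hz1⟩
  set R := √(residualSq n c A.card) with hR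
  -- Both weights `d` and `|c| √|A|` are at most the residual norm `R`, which makes the bound
  -- uniform in `c`.
  have hd : √(1 - (n : ℝ) * c ^ 2) ≤ R := Real.sqrt_le_sqrt (by
    have : 0 ≤ c ^ 2 * (A.card : ℝ) := by positivity
    rw [residualSq]; linarith)
  have hk : |c| * √(A.card : ℝ) ≤ R := by
    rw [← Real.sqrt_sq_eq_abs, ← Real.sqrt_mul (sq_nonneg c)]
    exact Real.sqrt_le_sqrt (by rw [residualSq]; linarith)
  calc _ ≤ √(1 - (n : ℝ) * c ^ 2) * |z (Fin.last n)| + |c| * |∑ i ∈ A, z i| := by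
        refine (abs_add_le _ _).trans_eq ?_
        rw [abs_mul, abs_mul, abs_of_nonneg (Real.sqrt_nonneg _)]
    _ ≤ √(1 - (n : ℝ) * c ^ 2) * (ε / 2 * √((n : ℝ) + 1)) +
        |c| * ((L + ε / 2) * (√((n : ℝ) + 1) * √(A.card : ℝ))) := by gcongr
    _ = √(1 - (n : ℝ) * c ^ 2) * (ε / 2 * √((n : ℝ) + 1)) +
        (|c| * √(A.card : ℝ)) * ((L + ε / 2) * √((n : ℝ) + 1)) := by ring
    _ ≤ R * (ε / 2 * √((n : ℝ) + 1)) + R * ((L + ε / 2) * √((n : ℝ) + 1)) := by gcongr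
    _ = _ := by ring

/-! ### Lower bound at a specific design. -/

lemma whp_notMem_levelSet {q t : ℝ} (hq : 0 ≤ q) (ht : q * √(normalTail t) < normalPDF t) :
    WHP fun n => (levelSet n (1 / √((n : ℝ) + 1)) (q * √((n : ℝ) + 1)))ᶜ := by
  -- One `η` absorbs the law of large numbers error; the other absorbs `z_p` in the sum and the `+1`
  -- in the cardinality.
  obtain ⟨η, hη, hlt⟩ : ∃ η > 0, q * √(normalTail t + 2 * η) < normalPDF t - 2 * η := by
    have h1 : ContinuousAt (fun η : ℝ => q * √(normalTail t + 2 * η)) 0 := by fun_prop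
    have h2 : ContinuousAt (fun η : ℝ => normalPDF t - 2 * η) 0 := by fun_prop
    have := h1.eventually_lt h2 (by simpa using ht)
    obtain ⟨η, h, hη⟩ := ((this.filter_mono nhdsWithin_le_nhds).and
      (self_mem_nhdsWithin (s := Ioi (0 : ℝ)))).exists
    exact ⟨η, hη, h⟩
  have h1 := whp_abs_sum_sub_lt (memLp_indicator_Ioi_id t) hη
  have h2 := whp_abs_sum_sub_lt (memLp_indicator_Ioi_one t) hη
  have h3 := whp_abs_last_lt hη
  refine ((h1.inter h2).inter h3).mono ?_
  filter_upwards [eventually_ge_atTop ⌈1 / η⌉₊] with n hn z hz hmem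
  obtain ⟨⟨hz1, hz2⟩, hz3⟩ := hz
  rw [mem_ofPred_eq] at hz1 hz2
  replace hz1 := (abs_lt.1 hz1).1
  replace hz2 := (abs_lt.1 hz2).2
  have hz3 : |z (Fin.last n)| < _ := hz3
  rw [integral_indicator_id] at hz1
  rw [integral_indicator_one] at hz2
  have hN : (0 : ℝ) < n + 1 := by positivity
  have hηN : 1 ≤ η * (n + 1) := by
    have : 1 / η ≤ n := (Nat.le_ceil _).trans (by exact_mod_cast hn)
    rw [div_le_iff₀ hη] at this
    nlinarith
  set r := √((n : ℝ) + 1) with hr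
  have hr0 : 0 < r := Real.sqrt_pos.2 hN
  have hr2 : r * r = n + 1 := Real.mul_self_sqrt hN.le
  have hr1 : r ≤ n + 1 := by
    have : 1 ≤ r := Real.one_le_sqrt.2 (by simp)
    nlinarith
  classical
  set A := (Finset.univ.filter fun i => t < z i).erase (Fin.last n) with hA
  -- For this `c` the weights `c` and `d` coincide, so the statistic is `(z_p + ∑_A z_i)/√(|A| +
  -- 1)`.
  have hd : √(1 - (n : ℝ) * (1 / r) ^ 2) = 1 / r := by
    rw [Real.sqrt_eq_iff_mul_self_eq (by
      rw [div_pow, sq r, hr2, one_pow, mul_one_div, sub_nonneg, div_le_one hN]; linarith)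
      (by positivity)]
    rw [div_pow, sq r, div_mul_div_comm, hr2]
    field_simp; ring
  have hres : √(residualSq n (1 / r) A.card) = √((A.card : ℝ) + 1) / r := by
    rw [hr, ← Real.sqrt_div (by positivity), ← hr]
    congr 1
    rw [residualSq, div_pow, sq r, hr2]
    field_simp; ring
  have hlev := le_of_abs_le (hmem A (by simp [hA]))
  rw [hd, hres, ← mul_add, one_div, inv_mul_le_iff₀ hr0] at hlev
  have hlev' : z (Fin.last n) + ∑ i ∈ A, z i ≤ q * r * √((A.card : ℝ) + 1) := by
    refine hlev.trans_eq ?_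
    field_simp
  have hsum : ∀ f : ℝ → ℝ, ∑ i, (Ioi t).indicator f (z i) =
      (Ioi t).indicator f (z (Fin.last n)) + ∑ i ∈ A, f (z i) := by
    intro f
    rw [← Finset.add_sum_erase _ _ (Finset.mem_univ (Fin.last n))]
    congr 1
    have : A = (Finset.univ.erase (Fin.last n)).filter fun i => t < z i := by
      ext i; simp [hA]
    rw [this, Finset.sum_filter]
    refine Finset.sum_congr rfl fun i _ => ?_
    simp [indicator_apply]
  have hcard : (A.card : ℝ) + 1 ≤ (n + 1) * (normalTail t + 2 * η) := by
    have h := hsum fun _ => 1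
    have h0 : 0 ≤ (Ioi t).indicator (fun _ => (1 : ℝ)) (z (Fin.last n)) :=
      indicator_nonneg (fun _ _ => zero_le_one) _
    simp only [Finset.sum_const, nsmul_eq_mul, mul_one] at h
    nlinarith
  have hS : (n + 1) * (normalPDF t - 2 * η) ≤ z (Fin.last n) + ∑ i ∈ A, z i := by
    have h := hsum fun x => x
    have h0 : (Ioi t).indicator (fun x => x) (z (Fin.last n)) ≤
        z (Fin.last n) + |z (Fin.last n)| := by
      by_cases hl : z (Fin.last n) ∈ Ioi t
      · rw [indicator_of_mem hl]; linarith [abs_nonneg (z (Fin.last n))]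
      · rw [indicator_of_notMem hl]; linarith [neg_abs_le (z (Fin.last n))]
    nlinarith
  have hfin : q * r * √((A.card : ℝ) + 1) ≤ (n + 1) * (q * √(normalTail t + 2 * η)) := by
    calc q * r * √((A.card : ℝ) + 1) ≤ q * r * √((n + 1) * (normalTail t + 2 * η)) := by gcongr
      _ = q * (r * r) * √(normalTail t + 2 * η) := by
        rw [Real.sqrt_mul hN.le, ← hr]; ring
      _ = _ := by rw [hr2]; ring
  have := mul_lt_mul_of_pos_left hlt hN
  linarith

lemma natCast_mul_sq_lt_one {n : ℕ} {c : ℝ} (h : c ^ 2 < 1 / (n : ℝ)) : (n : ℝ) * c ^ 2 < 1 := by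
  -- For `n = 0` the bound `1 / 0` is 0, but the goal is trivial.
  rcases n.eq_zero_or_pos with rfl | hn
  · simp
  · rw [lt_div_iff₀ (by exact_mod_cast hn)] at h
    linarith

end

end PoSI

/-! ### Assembly of the limit. -/

theorem theorem6p2 (α : ℝ) (hα0 : 0 < α) (hα1 : α < 1)
    (m : (n : ℕ) → Fin (n + 1) → ℝ) (s : ℕ → ℝ) (hs : ∀ n, 0 < s n) :
    ∃ L : ℝ,
      IsGreatest (PoSI.rateFun '' Set.Ioo 0 1) L ∧
      0.6363 ≤ L ∧ L < 0.6364 ∧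
      (∀ n : ℕ, ∀ c : ℝ, c ^ 2 < 1 / (n : ℝ) →
        IsLeast
          (PoSI.posi1Levels (PoSI.controlDesign n c)
            (PoSI.allModels (PoSI.controlDesign n c)) (Fin.last n) α (m n) (s n))
          (PoSI.posi1Constant (PoSI.controlDesign n c)
            (PoSI.allModels (PoSI.controlDesign n c)) (Fin.last n) α (m n) (s n))) ∧
      (∀ n : ℕ, BddAbove (Set.range (fun c : {c : ℝ // c ^ 2 < 1 / (n : ℝ)} =>
        PoSI.posi1Constant (PoSI.controlDesign n c)
          (PoSI.allModels (PoSI.controlDesign n c)) (Fin.last n) α (m n) (s n) /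
            Real.sqrt ((n : ℝ) + 1)))) ∧
      Filter.Tendsto
        (fun n : ℕ => ⨆ c : {c : ℝ // c ^ 2 < 1 / (n : ℝ)},
          PoSI.posi1Constant (PoSI.controlDesign n c)
            (PoSI.allModels (PoSI.controlDesign n c)) (Fin.last n) α (m n) (s n) /
              Real.sqrt ((n : ℝ) + 1))
        Filter.atTop (nhds L) := by
  obtain ⟨L, hL, hL1, hL2⟩ := PoSI.exists_isGreatest_rateFun
  have hrange := hL
  rw [PoSI.rateFun_image] at hrange
  have hrate : ∀ t, PoSI.normalPDF t ≤ L * √(PoSI.normalTail t) := fun t =>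
    (div_le_iff₀ (Real.sqrt_pos.2 (PoSI.normalTail_pos t))).1 (hrange.2 ⟨t, rfl⟩)
  obtain ⟨t, ht⟩ := hrange.1
  have hmin : ∀ n : ℕ, ∀ c : ℝ, c ^ 2 < 1 / (n : ℝ) →
      IsLeast {K | 1 - α ≤ (PoSI.stdLaw n).real (PoSI.levelSet n c K)}
        (PoSI.posi1Constant (PoSI.controlDesign n c)
          (PoSI.allModels (PoSI.controlDesign n c)) (Fin.last n) α (m n) (s n)) := by
    intro n c hc
    have hc' := PoSI.natCast_mul_sq_lt_one hc
    rw [PoSI.posi1Constant, PoSI.posi1Levels_eq hc' α (m n) (hs n)]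
    exact PoSI.isLeast_levels hc' hα0 hα1
  have hbdd : ∀ n : ℕ, BddAbove (Set.range (fun c : {c : ℝ // c ^ 2 < 1 / (n : ℝ)} =>
      PoSI.posi1Constant (PoSI.controlDesign n c)
        (PoSI.allModels (PoSI.controlDesign n c)) (Fin.last n) α (m n) (s n) /
          Real.sqrt ((n : ℝ) + 1))) := by
    intro n
    obtain ⟨K, hK⟩ := PoSI.exists_uniform_level n hα0
    refine ⟨K / √((n : ℝ) + 1), ?_⟩
    rintro _ ⟨c, rfl⟩
    exact div_le_div_of_nonneg_right
      ((hmin n c c.2).2 (hK c (PoSI.natCast_mul_sq_lt_one c.2))) (Real.sqrt_nonneg _)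
  refine ⟨L, hL, hL1, hL2, fun n c hc => ?_, hbdd, tendsto_order.2 ⟨fun a ha => ?_, fun b hb => ?_⟩⟩
  · rw [PoSI.posi1Levels_eq (PoSI.natCast_mul_sq_lt_one hc) α (m n) (hs n)]
    exact hmin n c hc
  -- `whp_notMem_levelSet` needs a nonnegative level, and `a` may be negative.
  · have hq : max a 0 < L := max_lt ha (by linarith)
    obtain ⟨q, hq0, hqL⟩ := exists_between hq
    have hqt : q * √(PoSI.normalTail t) < PoSI.normalPDF t :=
      (lt_div_iff₀ (Real.sqrt_pos.2 (PoSI.normalTail_pos t))).1 (hqL.trans_eq ht.symm)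
    have hwhp := PoSI.whp_notMem_levelSet ((le_max_right a 0).trans hq0.le) hqt
    -- Applied with `1 - α` in place of `α`: the complement of the level set has probability above
    -- `α`, so `q √p` is not an admissible level.
    filter_upwards [hwhp.eventually_le (sub_pos.2 hα1), Filter.eventually_gt_atTop 0] with n hn hn0
    have hn' : (0 : ℝ) < n := by exact_mod_cast hn0
    have hc : (1 / √((n : ℝ) + 1)) ^ 2 < 1 / (n : ℝ) := by
      rw [div_pow, Real.sq_sqrt (by positivity), one_pow]
      exact one_div_lt_one_div_of_lt hn' (by linarith)
    rw [probReal_compl_eq_one_sub (PoSI.isClosed_levelSet _ _ _).measurableSet] at hn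
    refine ((le_max_left a 0).trans_lt hq0).trans (lt_of_lt_of_le ?_
      (le_ciSup (hbdd n) ⟨1 / √((n : ℝ) + 1), hc⟩))
    rw [lt_div_iff₀ (by positivity)]
    by_contra! hle
    have h1 : 1 - α ≤ _ := (hmin n _ hc).1
    have h2 := measureReal_mono (μ := PoSI.stdLaw n)
      (PoSI.levelSet_mono (n := n) (c := 1 / √((n : ℝ) + 1)) hle)
    linarith
  · obtain ⟨b', hb', hbb⟩ := exists_between hb
    have hwhp := PoSI.whp_mem_levelSet hL1 hrate (sub_pos.2 hb')
    filter_upwards [hwhp.eventually_le hα0, Filter.eventually_gt_atTop 0] with n hn hn0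
    have hn' : (0 : ℝ) < n := by exact_mod_cast hn0
    -- For `n = 0` there is no admissible `c`; `ciSup_le` needs one.
    have : Nonempty {c : ℝ // c ^ 2 < 1 / (n : ℝ)} := ⟨⟨0, by simpa using hn'⟩⟩
    refine lt_of_le_of_lt (ciSup_le fun c => ?_) hbb
    rw [div_le_iff₀ (by positivity)]
    refine (hmin n c c.2).2 (hn.le.trans (measureReal_mono fun z hz => ?_))
    have := hz c (PoSI.natCast_mul_sq_lt_one c.2)
    rwa [add_sub_cancel] at this
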